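/- Let $\mathbb U=\{z\in\mathbb C:|z|<1\}$, let $0\le\lambda\le 1$ and $0\le\beta<1$. For functions $F,\varphi$ on $\mathbb U$ write $F\prec\varphi$ if there is an analytic $w:\mathbb U\to\mathbb U$ with $w(0)=0$ and $F(z)=\varphi(w(z))$ for all $z\in\mathbb U$. Let $f(z)=z+\sum_{n\ge 2}a_nz^n$ be analytic and bi-univalent in $\mathbb U$, that is, $f$ is univalent in $\mathbb U$ and its inverse $f^{-1}$ (defined near $0$) extends to a univalent analytic function $g$ on $\mathbb U$. Suppose that $f\in\mathcal G^{\lambda}_{\sigma}(\beta)$, that is, with $\varphi(z)=\frac{1+(1-2\beta)z}{1-z}$, $$(1-\lambda)f'(z)+\lambda\Big(1+\frac{zf''(z)}{f'(z)}\Big)\prec\varphi(z)\quad\text{and}\quad(1-\lambda)g'(w)+\lambda\Big(1+\frac{wg''(w)}{g'(w)}\Big)\prec\varphi(w)\qquad(z,w\in\mathbb U).$$ Put $$\beta_0(\lambda)=1-\frac{(1+2\lambda)+\sqrt{(1+2\lambda)^2+18(1+\lambda)^2(2-\lambda)}}{6(1+\lambda)(2-\lambda)}.$$ If $\beta\in[0,\beta_0(\lambda)]$,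 then $$|a_2a_4-a_3^2|\le\frac{(1-\beta)^2}{2(1+2\lambda)}\big[(2-\lambda)(1-\beta)^2+1\big],$$ and if $\beta\in(\beta_0(\lambda),1)$, then $$|a_2a_4-a_3^2|\le\frac{(1-\beta)^2}{72(1+2\lambda)}\cdot\frac{36\big[8(1+2\lambda)(2-\lambda)-(1+2\lambda)^2\big](1-\beta)^2-324(1+\lambda)(1+2\lambda)(1-\beta)+288(1+2\lambda)-729(1+\lambda)^2}{9(1+\lambda)^2(2-\lambda)(1-\beta)^2-6(1+\lambda)(1+2\lambda)(1-\beta)+8(1+2\lambda)-18(1+\lambda)^2}.$$ -/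

import Mathlib

open Topology

namespace BiUniv

noncomputable section

/-- The open unit disc `{z : ℂ | |z| < 1}`. -/
def unitDisc : Set ℂ := Metric.ball (0 : ℂ) 1

/-- The class `𝒜`: functions analytic in the unit disc, normalised so that the Taylor
expansion at `0` starts with `z`. -/
structure IsNormalizedAnalytic (f : ℂ → ℂ) : Prop where
  differentiableOn : DifferentiableOn ℂ f unitDisc
  map_zero : f 0 = 0
  deriv_zero : deriv f 0 = 1

/-- The class `𝒮`: the univalent members of `𝒜`. -/
structure IsSchlicht (f : ℂ → ℂ) : Prop where
  normalized : IsNormalizedAnalytic f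
  injOn : Set.InjOn f unitDisc

/-- `g` is the inverse of `f`, considered in the unit disc: `g` is analytic in the unit disc and
is there the (unique) analytic continuation of the local inverse of `f` at `0`. -/
structure IsDiscInverse (f g : ℂ → ℂ) : Prop where
  differentiableOn : DifferentiableOn ℂ g unitDisc
  left_inverse : ∀ᶠ z in 𝓝 (0 : ℂ), g (f z) = z

/-- The class `σ` of bi-univalent functions: `f` and its inverse are both univalent in the
unit disc. -/
structure IsBiUnivalent (f : ℂ → ℂ) : Prop where
  schlicht : IsSchlicht f
  inverse : ∃ g : ℂ → ℂ, IsDiscInverse f g ∧ Set.InjOn g unitDisc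

/-- Subordination `F ≺ φ` in the unit disc, through a Schwarz function `w`. -/
def IsSubordinate (F φ : ℂ → ℂ) : Prop :=
  ∃ w : ℂ → ℂ, DifferentiableOn ℂ w unitDisc ∧ w 0 = 0 ∧
    (∀ z ∈ unitDisc, ‖w z‖ < 1) ∧ ∀ z ∈ unitDisc, F z = φ (w z)

/-- The expression `(1 - lam) f'(z) + lam (1 + z f''(z) / f'(z))`. -/
def alAmiriReade (lam : ℝ) (f : ℂ → ℂ) (z : ℂ) : ℂ :=
  (1 - (lam : ℂ)) * deriv f z + (lam : ℂ) * (1 + z * deriv (deriv f) z / deriv f z)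

/-- The class of bi-univalent functions `f` such that the above expression, both for `f` and for
its inverse `g`, is subordinate to `φ`. -/
structure MemClassG (lam : ℝ) (φ f : ℂ → ℂ) : Prop where
  biUnivalent : IsBiUnivalent f
  subordinate : IsSubordinate (alAmiriReade lam f) φ
  subordinate_inverse :
    ∃ g : ℂ → ℂ, IsDiscInverse f g ∧ IsSubordinate (alAmiriReade lam g) φ

/-- The map `z ↦ (1 + (1 - 2 β) z) / (1 - z)` of the unit disc onto the half-plane
`Re > β`. -/
def halfPlaneMap (β : ℝ) (z : ℂ) : ℂ := (1 + (1 - 2 * (β : ℂ)) * z) / (1 - z)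

/-- The value of `β` at which the form of the bound changes. -/
def betaThreshold (lam : ℝ) : ℝ :=
  1 - ((1 + 2 * lam) + Real.sqrt ((1 + 2 * lam) ^ 2 + 18 * (1 + lam) ^ 2 * (2 - lam))) /
      (6 * (1 + lam) * (2 - lam))

end

end BiUniv

/-! Write `B = 1 - β` and let `w`, `v` be the Schwarz functions of the two subordinations. Clearing
denominators and comparing Taylor coefficients expresses `a₂`, `a₃`, `a₄` through `w₁`, `w₂`, `w₃`,
and the coefficients of the inverse through `v₁`, `v₂`, `v₃`. Since the inverse starts `w - a₂ w² +
(2 a₂² - a₃) w³ - …`, this forces `v₁ = -w₁`, and subtracting the two systems writes the Hankel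
determinant as a polynomial in `a₂`, `x = a₃ - a₂²` and a combination `y` of Schwarz coefficients
(`hankel_le_quadratic`).

The Schur algorithm bounds `w₂`, `w₃` by `m = |w₁|` and the modulus `γ` of the second Schur
parameter, with `δ` in that role for `v` (`schwarz_coeff_bounds`). After the triangle inequality,
`schur_parameters_le` shows that `γ = δ = 1` is the worst case. What remains is a real quadratic in
`s = m²` on `[0, 1]`. If its slope at `s = 1` is nonnegative, the maximum is at that endpoint and
gives the first bound; otherwise the quadratic is concave and its vertex value gives the second. The
sign of that slope changes at `betaThreshold`. -/

namespace BiUniv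

/-! ### Low-order coefficients of a product of power series. -/

section CoeffMul

variable {R : Type*} [CommRing R] (p q : PowerSeries R)

theorem coeff_zero_mul : PowerSeries.coeff 0 (p * q)
    = PowerSeries.coeff 0 p * PowerSeries.coeff 0 q := by
  simp

theorem coeff_one_mul : PowerSeries.coeff 1 (p * q)
    = PowerSeries.coeff 0 p * PowerSeries.coeff 1 q
      + PowerSeries.coeff 1 p * PowerSeries.coeff 0 q := by
  rw [PowerSeries.coeff_mul, Finset.Nat.sum_antidiagonal_eq_sum_range_succ_mk]
  simp [Finset.sum_range_succ]

theorem coeff_two_mul : PowerSeries.coeff 2 (p * q)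
    = PowerSeries.coeff 0 p * PowerSeries.coeff 2 q
      + PowerSeries.coeff 1 p * PowerSeries.coeff 1 q
      + PowerSeries.coeff 2 p * PowerSeries.coeff 0 q := by
  rw [PowerSeries.coeff_mul, Finset.Nat.sum_antidiagonal_eq_sum_range_succ_mk]
  simp [Finset.sum_range_succ]

theorem coeff_three_mul : PowerSeries.coeff 3 (p * q)
    = PowerSeries.coeff 0 p * PowerSeries.coeff 3 q
      + PowerSeries.coeff 1 p * PowerSeries.coeff 2 q
      + PowerSeries.coeff 2 p * PowerSeries.coeff 1 q
      + PowerSeries.coeff 3 p * PowerSeries.coeff 0 q := by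
  rw [PowerSeries.coeff_mul, Finset.Nat.sum_antidiagonal_eq_sum_range_succ_mk]
  simp [Finset.sum_range_succ]

theorem coeff_four_mul : PowerSeries.coeff 4 (p * q)
    = PowerSeries.coeff 0 p * PowerSeries.coeff 4 q
      + PowerSeries.coeff 1 p * PowerSeries.coeff 3 q
      + PowerSeries.coeff 2 p * PowerSeries.coeff 2 q
      + PowerSeries.coeff 3 p * PowerSeries.coeff 1 q
      + PowerSeries.coeff 4 p * PowerSeries.coeff 0 q := by
  rw [PowerSeries.coeff_mul, Finset.Nat.sum_antidiagonal_eq_sum_range_succ_mk]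
  simp [Finset.sum_range_succ]

end CoeffMul

/-! ### Taylor series at `0` as formal power series. -/

/-- The Taylor series at `0` of a function of one complex variable. -/
noncomputable def taylor (f : ℂ → ℂ) : PowerSeries ℂ :=
  PowerSeries.mk fun n => iteratedDeriv n f 0 / (n.factorial : ℂ)

theorem coeff_taylor (f : ℂ → ℂ) (n : ℕ) :
    PowerSeries.coeff n (taylor f) = iteratedDeriv n f 0 / (n.factorial : ℂ) :=
  PowerSeries.coeff_mk _ _

theorem taylor_congr {f g : ℂ → ℂ} (h : f =ᶠ[𝓝 0] g) : taylor f = taylor g := by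
  ext n
  rw [coeff_taylor, coeff_taylor, h.iteratedDeriv_eq]

theorem taylor_add {f g : ℂ → ℂ} (hf : AnalyticAt ℂ f 0) (hg : AnalyticAt ℂ g 0) :
    taylor (fun z => f z + g z) = taylor f + taylor g := by
  ext n
  rw [map_add, coeff_taylor, coeff_taylor, coeff_taylor,
    iteratedDeriv_fun_add hf.contDiffAt hg.contDiffAt, add_div]

theorem taylor_mul {f g : ℂ → ℂ} (hf : AnalyticAt ℂ f 0) (hg : AnalyticAt ℂ g 0) :
    taylor (fun z => f z * g z) = taylor f * taylor g := by
  ext n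
  rw [PowerSeries.coeff_mul, coeff_taylor, iteratedDeriv_fun_mul hf.contDiffAt hg.contDiffAt,
    Finset.Nat.sum_antidiagonal_eq_sum_range_succ_mk, Finset.sum_div]
  refine Finset.sum_congr rfl fun i hi => ?_
  have hi' : i ≤ n := Nat.lt_succ_iff.mp (Finset.mem_range.mp hi)
  rw [coeff_taylor, coeff_taylor, Nat.cast_choose ℂ hi']
  have h1 : (n.factorial : ℂ) ≠ 0 := Nat.cast_ne_zero.mpr n.factorial_ne_zero
  field_simp

theorem taylor_const (c : ℂ) : taylor (fun _ => c) = PowerSeries.C c := by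
  ext n
  rw [coeff_taylor, iteratedDeriv_const, PowerSeries.coeff_C]
  split_ifs with h <;> simp [h]

theorem taylor_id : taylor (fun z => z) = PowerSeries.X := by
  ext n
  rw [coeff_taylor, PowerSeries.coeff_X]
  match n with
  | 0 => simp
  | 1 => simp
  | n + 2 => simp [iteratedDeriv_succ']

theorem taylor_pow {f : ℂ → ℂ} (hf : AnalyticAt ℂ f 0) (n : ℕ) :
    taylor (fun z => f z ^ n) = taylor f ^ n := by
  induction n with
  | zero => simpa using taylor_const 1
  | succ n ih =>
    simp only [pow_succ]
    rw [taylor_mul (hf.fun_pow n) hf, ih]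

theorem taylor_id_pow (n : ℕ) : taylor (fun z => z ^ n) = PowerSeries.X ^ n := by
  rw [taylor_pow (f := fun z => z) analyticAt_id, taylor_id]

theorem taylor_id_mul {f : ℂ → ℂ} (hf : AnalyticAt ℂ f 0) :
    taylor (fun z => z * f z) = PowerSeries.X * taylor f := by
  rw [taylor_mul (f := fun z => z) analyticAt_id hf, taylor_id]

theorem coeff_taylor_deriv (f : ℂ → ℂ) (n : ℕ) :
    PowerSeries.coeff n (taylor (deriv f)) = (n + 1) * PowerSeries.coeff (n + 1) (taylor f) := by
  rw [coeff_taylor, coeff_taylor, ← iteratedDeriv_succ', Nat.factorial_succ]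
  have h1 : (n.factorial : ℂ) ≠ 0 := Nat.cast_ne_zero.mpr n.factorial_ne_zero
  have h2 : (n : ℂ) + 1 ≠ 0 := Nat.cast_add_one_ne_zero n
  push_cast
  field_simp

theorem coeff_zero_taylor (f : ℂ → ℂ) : PowerSeries.coeff 0 (taylor f) = f 0 := by
  simp [coeff_taylor]

/-- Serves to handle composites: substituting `f` with `f 0 = 0` for `z` leaves powers of `f` and a
remainder that does not affect coefficients below `n`. -/
theorem exists_taylor_expansion {f : ℂ → ℂ} (hf : AnalyticAt ℂ f 0) (n : ℕ) :
    ∃ r : ℂ → ℂ, AnalyticAt ℂ r 0 ∧ ∀ᶠ z in 𝓝 0,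
      f z = (∑ i ∈ Finset.range n, PowerSeries.coeff i (taylor f) * z ^ i) + z ^ n * r z := by
  have key : ∃ (c : ℕ → ℂ) (r : ℂ → ℂ), AnalyticAt ℂ r 0 ∧ ∀ᶠ z in 𝓝 0,
      f z = (∑ i ∈ Finset.range n, c i * z ^ i) + z ^ n * r z := by
    induction n with
    | zero => exact ⟨0, f, hf, by simp⟩
    | succ n ih =>
      obtain ⟨c, r, hr, h⟩ := ih
      -- The remainder is peeled once more: `r z = r 0 + z * dslope r 0 z`, so `r 0` becomes the
      -- coefficient of index `n`.
      refine ⟨fun i => if i = n then r 0 else c i, dslope r 0, ?_, ?_⟩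
      · obtain ⟨p, hp⟩ := hr
        exact ⟨_, hp.has_fpower_series_dslope_fslope⟩
      · filter_upwards [h] with z hz
        have h1 : z * dslope r 0 z = r z - r 0 := by
          simpa using sub_smul_dslope r 0 z
        have h2 : ∑ i ∈ Finset.range n, (if i = n then r 0 else c i) * z ^ i
            = ∑ i ∈ Finset.range n, c i * z ^ i :=
          Finset.sum_congr rfl fun i hi => by rw [if_neg (Finset.mem_range.mp hi).ne]
        rw [hz, Finset.sum_range_succ, h2, if_pos rfl, pow_succ, mul_assoc, h1]
        ring
  obtain ⟨c, r, hr, h⟩ := key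
  refine ⟨r, hr, ?_⟩
  have hsum : ∀ m : ℕ, AnalyticAt ℂ (fun z : ℂ => ∑ i ∈ Finset.range m, c i * z ^ i) 0 ∧
      taylor (fun z : ℂ => ∑ i ∈ Finset.range m, c i * z ^ i)
        = ∑ i ∈ Finset.range m, PowerSeries.C (c i) * PowerSeries.X ^ i := by
    intro m
    induction m with
    | zero =>
      simp only [Finset.range_zero, Finset.sum_empty]
      exact ⟨analyticAt_const, by rw [taylor_const, map_zero]⟩
    | succ m ih =>
      have hm : AnalyticAt ℂ (fun z : ℂ => c m * z ^ m) 0 := by fun_prop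
      simp only [Finset.sum_range_succ]
      refine ⟨ih.1.fun_add hm, ?_⟩
      rw [taylor_add ih.1 hm, ih.2, taylor_mul analyticAt_const (by fun_prop), taylor_const,
        taylor_id_pow]
  have hT : taylor f = ∑ i ∈ Finset.range n, PowerSeries.C (c i) * PowerSeries.X ^ i
      + PowerSeries.X ^ n * taylor r := by
    rw [taylor_congr h, taylor_add (hsum n).1 (by fun_prop), (hsum n).2,
      taylor_mul (by fun_prop) hr, taylor_id_pow]
  have hc : ∀ i ∈ Finset.range n, PowerSeries.coeff i (taylor f) = c i := by
    intro i hi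
    rw [hT, map_add, map_sum, PowerSeries.coeff_X_pow_mul',
      if_neg (not_le.mpr (Finset.mem_range.mp hi)), add_zero]
    simp only [PowerSeries.coeff_C_mul, PowerSeries.coeff_X_pow]
    simp [Finset.mem_range.mp hi]
  filter_upwards [h] with z hz
  rw [hz]
  congr 1
  exact Finset.sum_congr rfl fun i hi => by rw [hc i hi]

/-- The coefficients of a convergent power series are its Taylor coefficients. -/
theorem coeff_taylor_of_hasSum {f : ℂ → ℂ} {c : ℕ → ℂ}
    (h : ∀ z ∈ unitDisc, HasSum (fun n => c n * z ^ n) (f z)) (n : ℕ) :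
    PowerSeries.coeff n (taylor f) = c n := by
  have hp : HasFPowerSeriesAt f (FormalMultilinearSeries.ofScalars ℂ c) 0 := by
    rw [hasFPowerSeriesAt_iff]
    filter_upwards [Metric.ball_mem_nhds (0 : ℂ) one_pos] with z hz
    simpa [FormalMultilinearSeries.coeff_ofScalars, mul_comm] using h z hz
  have h1 := hp.eq_formalMultilinearSeries hp.analyticAt.hasFPowerSeriesAt
  have h2 := congrArg (fun p => FormalMultilinearSeries.coeff p n) h1
  simp only [FormalMultilinearSeries.coeff_ofScalars] at h2
  rw [h2, coeff_taylor]

/-! ### The Schur algorithm and coefficients of Schwarz functions. -/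

open Metric ComplexConjugate

/-- Möbius transformations of the disc do not increase the norm beyond `1`. -/
theorem norm_sub_le_norm_one_sub_conj_mul {a z : ℂ} (ha : ‖a‖ ≤ 1) (hz : ‖z‖ ≤ 1) :
    ‖z - a‖ ≤ ‖1 - conj a * z‖ := by
  rw [← sq_le_sq₀ (norm_nonneg _) (norm_nonneg _), Complex.sq_norm, Complex.sq_norm]
  have ha' : ‖a‖ ^ 2 ≤ 1 := pow_le_one₀ (norm_nonneg _) ha
  have hz' : ‖z‖ ^ 2 ≤ 1 := pow_le_one₀ (norm_nonneg _) hz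
  rw [Complex.sq_norm, Complex.normSq_apply] at ha' hz'
  simp only [Complex.normSq_apply, Complex.sub_re, Complex.sub_im, Complex.mul_re, Complex.mul_im,
    Complex.conj_re, Complex.conj_im, Complex.one_re, Complex.one_im]
  nlinarith [mul_nonneg (sub_nonneg.mpr ha') (sub_nonneg.mpr hz')]

/-- One step of the Schur algorithm. -/
theorem exists_schur_step {h : ℂ → ℂ} (hd : DifferentiableOn ℂ h unitDisc)
    (hb : ∀ z ∈ unitDisc, ‖h z‖ ≤ 1) :
    ∃ k : ℂ → ℂ, DifferentiableOn ℂ k unitDisc ∧ (∀ z ∈ unitDisc, ‖k z‖ ≤ 1) ∧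
      ∀ z ∈ unitDisc, h z * (1 + conj (h 0) * (z * k z)) = h 0 + z * k z := by
  have h0 : (0 : ℂ) ∈ unitDisc := mem_ball_self one_pos
  rcases (hb 0 h0).lt_or_eq with hlt | heq
  · have hne : ∀ z ∈ unitDisc, 1 - conj (h 0) * h z ≠ 0 := by
      intro z hz hzero
      have h1 : ‖conj (h 0) * h z‖ = 1 := by rw [← sub_eq_zero.mp hzero, norm_one]
      rw [norm_mul, RCLike.norm_conj] at h1
      nlinarith [hb z hz, norm_nonneg (h 0), norm_nonneg (h z)]
    set m : ℂ → ℂ := fun z => (h z - h 0) / (1 - conj (h 0) * h z) with hm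
    have hm0 : m 0 = 0 := by simp [hm]
    have hmd : DifferentiableOn ℂ m unitDisc :=
      (hd.sub_const _).div ((differentiableOn_const _).sub ((differentiableOn_const _).mul hd)) hne
    have hmb : Set.MapsTo m (ball 0 1) (closedBall (m 0) 1) := by
      intro z hz
      rw [hm0, mem_closedBall_zero_iff, hm, norm_div]
      exact div_le_one_of_le₀ (norm_sub_le_norm_one_sub_conj_mul hlt.le (hb z hz)) (norm_nonneg _)
    refine ⟨dslope m 0, (Complex.differentiableOn_dslope (ball_mem_nhds _ one_pos)).mpr hmd,
      fun z hz => ?_, fun z hz => ?_⟩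
    · simpa using Complex.norm_dslope_le_div_of_mapsTo_ball hmd hmb hz
    · have h1 : z * dslope m 0 z = m z := by
        simpa [hm0] using sub_smul_dslope m 0 z
      have h2 : m z * (1 - conj (h 0) * h z) = h z - h 0 := div_mul_cancel₀ _ (hne z hz)
      rw [h1]
      linear_combination -h2
  -- Here `|h 0| = 1`, so the maximum principle makes `h` constant and `k = 0` works; the relation
  -- is stated without division so that it covers this case.
  · have hconst : Set.EqOn h (Function.const ℂ (h 0)) unitDisc :=
      Complex.eqOn_of_isPreconnected_of_isMaxOn_norm (convex_ball _ _).isPreconnected isOpen_ball hd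
        h0 (fun z hz => by simpa [heq] using hb z hz)
    exact ⟨0, differentiableOn_const 0, by simp, fun z hz => by simpa using hconst hz⟩

theorem analyticAt_of_differentiableOn {h : ℂ → ℂ} (hd : DifferentiableOn ℂ h unitDisc) :
    AnalyticAt ℂ h 0 := hd.analyticAt (ball_mem_nhds _ one_pos)

theorem unitDisc_mem_nhds : unitDisc ∈ 𝓝 (0 : ℂ) := ball_mem_nhds _ one_pos

/-- The relation between the Taylor series of a function and of its Schur transform. -/
theorem taylor_schur_step {h k : ℂ → ℂ} (hd : DifferentiableOn ℂ h unitDisc)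
    (kd : DifferentiableOn ℂ k unitDisc)
    (hk : ∀ z ∈ unitDisc, h z * (1 + conj (h 0) * (z * k z)) = h 0 + z * k z) :
    taylor h * (1 + PowerSeries.C (conj (h 0)) * (PowerSeries.X * taylor k))
      = PowerSeries.C (h 0) + PowerSeries.X * taylor k := by
  have ha := analyticAt_of_differentiableOn hd
  have ka := analyticAt_of_differentiableOn kd
  have h1 := taylor_congr (Filter.eventually_of_mem unitDisc_mem_nhds hk)
  rw [taylor_mul ha (by fun_prop), taylor_add analyticAt_const (by fun_prop),
    taylor_mul analyticAt_const (by fun_prop), taylor_id_mul ka,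
    taylor_add analyticAt_const (by fun_prop), taylor_id_mul ka, taylor_const,
    taylor_const, taylor_const, map_one] at h1
  exact h1

/-- Obtained by comparing coefficients in the Schur relation. The first coefficient of `k` is left
unexpanded so that the lemma can be applied again to `k`. -/
theorem exists_schur_parameter {h : ℂ → ℂ} (hd : DifferentiableOn ℂ h unitDisc)
    (hb : ∀ z ∈ unitDisc, ‖h z‖ ≤ 1) :
    ∃ k : ℂ → ℂ, DifferentiableOn ℂ k unitDisc ∧ (∀ z ∈ unitDisc, ‖k z‖ ≤ 1) ∧
      PowerSeries.coeff 1 (taylor h) = (1 - ‖h 0‖ ^ 2 : ℝ) * k 0 ∧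
      PowerSeries.coeff 2 (taylor h) = (1 - ‖h 0‖ ^ 2 : ℝ) *
        (PowerSeries.coeff 1 (taylor k) - conj (h 0) * k 0 ^ 2) := by
  obtain ⟨k, kd, kb, hk⟩ := exists_schur_step hd hb
  have hT := taylor_schur_step hd kd hk
  have h1 := congrArg (PowerSeries.coeff 1) hT
  have h2 := congrArg (PowerSeries.coeff 2) hT
  have hn : ((1 - ‖h 0‖ ^ 2 : ℝ) : ℂ) = 1 - conj (h 0) * h 0 := by
    rw [Complex.conj_mul']; push_cast; rfl
  simp only [map_add, coeff_one_mul, coeff_two_mul, coeff_zero_mul, PowerSeries.coeff_one,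
    PowerSeries.coeff_X, PowerSeries.coeff_C, coeff_zero_taylor] at h1 h2
  norm_num at h1 h2
  refine ⟨k, kd, kb, ?_, ?_⟩
  · rw [hn]; linear_combination h1
  · rw [hn]; linear_combination h2 - conj (h 0) * k 0 * h1

/-- Sharp bounds for the first three coefficients of a Schwarz function. -/
theorem schwarz_coeff_bounds {w : ℂ → ℂ} (hd : DifferentiableOn ℂ w unitDisc) (h0 : w 0 = 0)
    (hb : ∀ z ∈ unitDisc, ‖w z‖ < 1) :
    ∃ γ : ℝ, 0 ≤ γ ∧ γ ≤ 1 ∧ ‖PowerSeries.coeff 1 (taylor w)‖ ≤ 1 ∧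
      ‖PowerSeries.coeff 2 (taylor w)‖ ≤ (1 - ‖PowerSeries.coeff 1 (taylor w)‖ ^ 2) * γ ∧
      ‖PowerSeries.coeff 3 (taylor w)‖ ≤ (1 - ‖PowerSeries.coeff 1 (taylor w)‖ ^ 2) *
        (‖PowerSeries.coeff 1 (taylor w)‖ * γ ^ 2 + (1 - γ ^ 2)) := by
  have m0 : (0 : ℂ) ∈ unitDisc := mem_ball_self one_pos
  have hmaps : Set.MapsTo w (ball 0 1) (closedBall (w 0) 1) := by
    intro z hz
    rw [h0, mem_closedBall_zero_iff]
    exact (hb z hz).le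
  set h := dslope w 0 with hh
  have hhd : DifferentiableOn ℂ h unitDisc :=
    (Complex.differentiableOn_dslope (ball_mem_nhds _ one_pos)).mpr hd
  have hhb : ∀ z ∈ unitDisc, ‖h z‖ ≤ 1 := fun z hz => by
    simpa using Complex.norm_dslope_le_div_of_mapsTo_ball hd hmaps hz
  have hT : taylor w = PowerSeries.X * taylor h := by
    rw [← taylor_id_mul (analyticAt_of_differentiableOn hhd)]
    refine congrArg taylor (funext fun z => ?_)
    simpa [h0] using (sub_smul_dslope w 0 z).symm
  obtain ⟨k, kd, kb, hk1, hk2⟩ := exists_schur_parameter hhd hhb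
  obtain ⟨l, ld, lb, hl1, -⟩ := exists_schur_parameter kd kb
  have hP : 0 ≤ 1 - ‖h 0‖ ^ 2 := sub_nonneg.mpr (pow_le_one₀ (norm_nonneg _) (hhb 0 m0))
  have hQ : 0 ≤ 1 - ‖k 0‖ ^ 2 := sub_nonneg.mpr (pow_le_one₀ (norm_nonneg _) (kb 0 m0))
  have e1 : PowerSeries.coeff 1 (taylor w) = h 0 := by
    rw [hT, PowerSeries.coeff_succ_X_mul 0, coeff_zero_taylor]
  have e2 : PowerSeries.coeff 2 (taylor w) = (1 - ‖h 0‖ ^ 2 : ℝ) * k 0 := by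
    rw [hT, PowerSeries.coeff_succ_X_mul 1, hk1]
  have e3 : PowerSeries.coeff 3 (taylor w) = (1 - ‖h 0‖ ^ 2 : ℝ) *
        ((1 - ‖k 0‖ ^ 2 : ℝ) * l 0 - conj (h 0) * k 0 ^ 2) := by
    rw [hT, PowerSeries.coeff_succ_X_mul 2, hk2, hl1]
  refine ⟨‖k 0‖, norm_nonneg _, kb 0 m0, ?_, ?_, ?_⟩
  · rw [e1]; exact hhb 0 m0
  · rw [e2, e1, norm_mul, Complex.norm_real, Real.norm_of_nonneg hP]
  · rw [e3, e1, norm_mul, Complex.norm_real, Real.norm_of_nonneg hP]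
    refine mul_le_mul_of_nonneg_left ((norm_sub_le _ _).trans ?_) hP
    rw [norm_mul, norm_mul, norm_pow, RCLike.norm_conj, Complex.norm_real, Real.norm_of_nonneg hQ]
    have := mul_le_of_le_one_right hQ (lb 0 m0)
    linarith


/-! ### Coefficient relations for the inverse and for the subordination. -/

theorem coeff_one_taylor (f : ℂ → ℂ) : PowerSeries.coeff 1 (taylor f) = deriv f 0 := by
  simp [coeff_taylor]

/-- Coefficients of a local inverse. -/
theorem coeff_taylor_inverse {f g : ℂ → ℂ} (hf : AnalyticAt ℂ f 0) (hg : AnalyticAt ℂ g 0)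
    (f0 : f 0 = 0) (f1 : deriv f 0 = 1) (hgf : ∀ᶠ z in 𝓝 (0 : ℂ), g (f z) = z)
    {a b : ℕ → ℂ} (ha : ∀ n, PowerSeries.coeff n (taylor f) = a n)
    (hb : ∀ n, PowerSeries.coeff n (taylor g) = b n) :
    b 1 = 1 ∧ b 2 = -a 2 ∧ b 3 = 2 * a 2 ^ 2 - a 3 ∧
      b 4 = -(5 * a 2 ^ 3 - 5 * a 2 * a 3 + a 4) := by
  obtain ⟨r, hr, hexp⟩ := exists_taylor_expansion hg 5
  have htend : Filter.Tendsto f (𝓝 0) (𝓝 0) := by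
    simpa [f0] using hf.continuousAt.tendsto
  have hrf : AnalyticAt ℂ (fun z => r (f z)) 0 := by
    have hr' : AnalyticAt ℂ r (f 0) := by rwa [f0]
    exact hr'.fun_comp hf
  have heq : (fun z : ℂ => z) =ᶠ[𝓝 0] fun z => b 0 + b 1 * f z + b 2 * f z ^ 2 + b 3 * f z ^ 3
      + b 4 * f z ^ 4 + f z ^ 5 * r (f z) := by
    filter_upwards [hgf, htend.eventually hexp] with z h1 h2
    rw [h1] at h2
    simp only [Finset.sum_range_succ, Finset.sum_range_zero, hb] at h2
    linear_combination h2
  have hT := taylor_congr heq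
  rw [taylor_id, taylor_add (by fun_prop) ((hf.fun_pow 5).fun_mul hrf), taylor_add (by fun_prop) (by fun_prop),
    taylor_add (by fun_prop) (by fun_prop), taylor_add (by fun_prop) (by fun_prop),
    taylor_add (by fun_prop) (by fun_prop), taylor_mul (hf.fun_pow 5) hrf,
    taylor_mul analyticAt_const (by fun_prop), taylor_mul analyticAt_const (by fun_prop),
    taylor_mul analyticAt_const (by fun_prop), taylor_mul analyticAt_const (by fun_prop),
    taylor_pow hf, taylor_pow hf, taylor_pow hf, taylor_pow hf, taylor_const, taylor_const,
    taylor_const, taylor_const, taylor_const] at hT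
  have a0 : a 0 = 0 := by rw [← ha, coeff_zero_taylor, f0]
  have a1 : a 1 = 1 := by rw [← ha, coeff_one_taylor, f1]
  have h1 := congrArg (PowerSeries.coeff 1) hT
  have h2 := congrArg (PowerSeries.coeff 2) hT
  have h3 := congrArg (PowerSeries.coeff 3) hT
  have h4 := congrArg (PowerSeries.coeff 4) hT
  simp only [map_add, PowerSeries.coeff_C_mul, pow_succ, pow_zero, one_mul, coeff_zero_mul,
    coeff_one_mul, coeff_two_mul, coeff_three_mul, coeff_four_mul, ha, a0, a1,
    PowerSeries.coeff_C, PowerSeries.coeff_X] at h1 h2 h3 h4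
  norm_num at h1 h2 h3 h4
  rw [← h1] at h2 h3 h4
  have e2 : b 2 = -a 2 := by linear_combination -h2
  rw [e2] at h3 h4
  have e3 : b 3 = 2 * a 2 ^ 2 - a 3 := by linear_combination -h3
  rw [e3] at h4
  exact ⟨h1.symm, e2, e3, by linear_combination -h4⟩

/-- The first coefficients of a function whose Al-Amiri-Reade expression is subordinate to the
half-plane map. -/
theorem coeff_of_isSubordinate {lam β : ℝ} {f : ℂ → ℂ} (hd : DifferentiableOn ℂ f unitDisc)
    (f1 : deriv f 0 = 1) (hs : IsSubordinate (alAmiriReade lam f) (halfPlaneMap β))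
    {a : ℕ → ℂ} (ha : ∀ n, PowerSeries.coeff n (taylor f) = a n) :
    ∃ (w₁ w₂ w₃ : ℂ) (γ : ℝ), 0 ≤ γ ∧ γ ≤ 1 ∧ ‖w₁‖ ≤ 1 ∧ ‖w₂‖ ≤ (1 - ‖w₁‖ ^ 2) * γ ∧
      ‖w₃‖ ≤ (1 - ‖w₁‖ ^ 2) * (‖w₁‖ * γ ^ 2 + (1 - γ ^ 2)) ∧
      a 2 = (1 - β) * w₁ ∧
      3 * (1 + lam) * a 3 - 4 * lam * a 2 ^ 2 = 2 * (1 - β) * (w₂ + w₁ ^ 2) ∧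
      4 * (1 + 2 * lam) * a 4 - 18 * lam * a 2 * a 3 + 8 * lam * a 2 ^ 3
        = 2 * (1 - β) * (w₃ + 2 * w₁ * w₂ + w₁ ^ 3) := by
  obtain ⟨w, wd, w0, wb, hw⟩ := hs
  obtain ⟨γ, hγ0, hγ1, hb1, hb2, hb3⟩ := schwarz_coeff_bounds wd w0 wb
  have hfa := analyticAt_of_differentiableOn hd
  have hf' : AnalyticAt ℂ (deriv f) 0 := hfa.deriv
  have hf'' : AnalyticAt ℂ (deriv (deriv f)) 0 := hf'.deriv
  have hwa := analyticAt_of_differentiableOn wd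
  have hne : ∀ᶠ z in 𝓝 (0 : ℂ), deriv f z ≠ 0 :=
    hf'.continuousAt.eventually_ne (by rw [f1]; exact one_ne_zero)
  -- The subordination multiplied by `f' * (1 - w)`, so that only sums and products of analytic
  -- functions remain.
  have heq : (fun z => ((1 - (lam : ℂ)) * deriv f z ^ 2
        + (lam : ℂ) * (deriv f z + z * deriv (deriv f) z)) * (1 + (-1) * w z))
      =ᶠ[𝓝 0] fun z => deriv f z * (1 + (1 - 2 * (β : ℂ)) * w z) := by
    filter_upwards [hne, unitDisc_mem_nhds] with z hz hzU
    have h1 : 1 - w z ≠ 0 := by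
      intro h0
      have := wb z hzU
      rw [← sub_eq_zero.mp h0, norm_one] at this
      exact lt_irrefl _ this
    have h2 := hw z hzU
    rw [alAmiriReade, halfPlaneMap, eq_div_iff h1] at h2
    have h3 : deriv f z * (z * deriv (deriv f) z / deriv f z) = z * deriv (deriv f) z :=
      mul_div_cancel₀ _ hz
    linear_combination deriv f z * h2 - lam * (1 - w z) * h3
  have hT := taylor_congr heq
  rw [taylor_mul (by fun_prop) (by fun_prop), taylor_mul (by fun_prop) (by fun_prop),
    taylor_add (by fun_prop) (by fun_prop), taylor_add (by fun_prop) (by fun_prop),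
    taylor_add (by fun_prop) (by fun_prop), taylor_mul analyticAt_const (by fun_prop),
    taylor_mul analyticAt_const (by fun_prop), taylor_mul analyticAt_const (by fun_prop),
    taylor_mul analyticAt_const (by fun_prop), taylor_add (by fun_prop) (by fun_prop),
    taylor_pow hf', taylor_id_mul hf'', taylor_const, taylor_const, taylor_const, taylor_const,
    taylor_const] at hT
  have a1 : a 1 = 1 := by rw [← ha, coeff_one_taylor, f1]
  have h1 := congrArg (PowerSeries.coeff 1) hT
  have h2 := congrArg (PowerSeries.coeff 2) hT
  have h3 := congrArg (PowerSeries.coeff 3) hT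
  simp only [map_add, PowerSeries.coeff_C_mul, pow_two, coeff_zero_mul, coeff_one_mul,
    coeff_two_mul, coeff_three_mul, coeff_taylor_deriv, ha, a1, coeff_zero_taylor w, w0,
    PowerSeries.coeff_C, PowerSeries.coeff_X] at h1 h2 h3
  norm_num [a1, ha] at h1 h2 h3
  generalize PowerSeries.coeff 1 (taylor w) = w₁ at *
  generalize PowerSeries.coeff 2 (taylor w) = w₂ at *
  generalize PowerSeries.coeff 3 (taylor w) = w₃ at *
  refine ⟨w₁, w₂, w₃, γ, hγ0, hγ1, hb1, hb2, hb3, ?_, ?_, ?_⟩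
  · linear_combination h1 / 2
  · linear_combination h2 + (w₁ - 2 * a 2) * h1
  · linear_combination h3 + (w₁ - 2 * a 2) * h2
      + (w₂ + w₁ ^ 2 - 2 * a 2 * w₁ + 4 * a 2 ^ 2 - 3 * a 3) * h1


/-! ### Estimating the Hankel determinant. -/

/-- The modulus bound is largest when both second Schur parameters have modulus one. -/
theorem schur_parameters_le {m γ δ e : ℝ} (hm0 : 0 ≤ m) (hm1 : m ≤ 1) (hγ0 : 0 ≤ γ) (hγ1 : γ ≤ 1)
    (hδ0 : 0 ≤ δ) (hδ1 : δ ≤ 1) (he : 2 / 3 ≤ e) :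
    2 * m * (2 - (1 - m) * (γ ^ 2 + δ ^ 2)) + 4 * m ^ 2 * (γ + δ)
      ≤ 12 * m ^ 2 + e * (1 - m ^ 2) * (4 - (γ + δ) ^ 2) := by
  have h1 : 0 ≤ (1 - m ^ 2) * (4 - (γ + δ) ^ 2) :=
    mul_nonneg (by nlinarith) (by nlinarith)
  have h2 := mul_le_mul_of_nonneg_right he h1
  have h3 : 0 ≤ m * (1 - m) * (γ - δ) ^ 2 :=
    mul_nonneg (mul_nonneg hm0 (by linarith)) (sq_nonneg _)
  -- With `γ² + δ² = ((γ + δ)² + (γ - δ)²) / 2` and `e` replaced by `2 / 3`, the difference of the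
  -- two sides is this product plus the square term `h3`.
  have h4 : 0 ≤ (2 - (γ + δ)) * (4 * m ^ 2 + (1 - m) * (2 + (γ + δ)) * (2 / 3 - m / 3)) := by
    refine mul_nonneg (by linarith) (add_nonneg (by positivity) ?_)
    exact mul_nonneg (mul_nonneg (by linarith) (by linarith)) (by linarith)
  linarith

/-- The Hankel determinant in terms of the squared modulus of the first Schwarz coefficient. -/
theorem hankel_le_quadratic {lam B : ℝ} (hlam0 : 0 ≤ lam) (hlam1 : lam ≤ 1) (hB : 0 < B)
    {a₂ a₃ a₄ w₁ w₂ w₃ v₁ v₂ v₃ : ℂ} {γ δ : ℝ}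
    (hγ0 : 0 ≤ γ) (hγ1 : γ ≤ 1) (hδ0 : 0 ≤ δ) (hδ1 : δ ≤ 1) (hw₁ : ‖w₁‖ ≤ 1)
    (hw₂ : ‖w₂‖ ≤ (1 - ‖w₁‖ ^ 2) * γ)
    (hw₃ : ‖w₃‖ ≤ (1 - ‖w₁‖ ^ 2) * (‖w₁‖ * γ ^ 2 + (1 - γ ^ 2)))
    (hv₂ : ‖v₂‖ ≤ (1 - ‖v₁‖ ^ 2) * δ)
    (hv₃ : ‖v₃‖ ≤ (1 - ‖v₁‖ ^ 2) * (‖v₁‖ * δ ^ 2 + (1 - δ ^ 2)))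
    (f₂ : a₂ = B * w₁)
    (f₃ : 3 * (1 + lam) * a₃ - 4 * lam * a₂ ^ 2 = 2 * B * (w₂ + w₁ ^ 2))
    (f₄ : 4 * (1 + 2 * lam) * a₄ - 18 * lam * a₂ * a₃ + 8 * lam * a₂ ^ 3
      = 2 * B * (w₃ + 2 * w₁ * w₂ + w₁ ^ 3))
    (g₂ : -a₂ = B * v₁)
    (g₃ : 3 * (1 + lam) * (2 * a₂ ^ 2 - a₃) - 4 * lam * (-a₂) ^ 2 = 2 * B * (v₂ + v₁ ^ 2))
    (g₄ : 4 * (1 + 2 * lam) * -(5 * a₂ ^ 3 - 5 * a₂ * a₃ + a₄)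
      - 18 * lam * (-a₂) * (2 * a₂ ^ 2 - a₃) + 8 * lam * (-a₂) ^ 3
      = 2 * B * (v₃ + 2 * v₁ * v₂ + v₁ ^ 3)) :
    ∃ s : ℝ, 0 ≤ s ∧ s ≤ 1 ∧ 72 * (1 + 2 * lam) * (1 + lam) ^ 2 * ‖a₂ * a₄ - a₃ ^ 2‖ ≤
      B ^ 2 * (36 * (1 + lam) ^ 2 * ((2 - lam) * B ^ 2 + 1) * s ^ 2
        + (24 * (1 + 2 * lam) * (1 + lam) * B + 108 * (1 + lam) ^ 2) * s * (1 - s)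
        + 32 * (1 + 2 * lam) * (1 - s) ^ 2) := by
  have hBc : (B : ℂ) ≠ 0 := Complex.ofReal_ne_zero.mpr hB.ne'
  have hv₁ : v₁ = -w₁ := mul_left_cancel₀ hBc (by rw [← g₂, f₂]; ring)
  subst hv₁
  rw [norm_neg] at hv₂ hv₃
  set m := ‖w₁‖ with hm
  have hm0 : 0 ≤ m := norm_nonneg _
  have hP : 0 ≤ 1 - m ^ 2 := by nlinarith
  set x := a₃ - a₂ ^ 2 with hx
  set y := w₃ - v₃ + 2 * w₁ * (w₂ + v₂) + 2 * w₁ ^ 3 with hy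
  have hxeq : ((3 * (1 + lam) : ℝ) : ℂ) * x = B * (w₂ - v₂) := by
    push_cast
    linear_combination (f₃ - g₃) / 2
  have hxn : 3 * (1 + lam) * ‖x‖ ≤ B * ((1 - m ^ 2) * (γ + δ)) := by
    have h1 := congrArg norm hxeq
    rw [norm_mul, norm_mul, Complex.norm_real, Complex.norm_real, Real.norm_of_nonneg hB.le,
      Real.norm_of_nonneg (by linarith)] at h1
    rw [h1]
    exact mul_le_mul_of_nonneg_left ((norm_sub_le _ _).trans (by linarith)) hB.le
  have hyn : ‖y‖ ≤ (1 - m ^ 2) * (2 - (1 - m) * (γ ^ 2 + δ ^ 2))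
      + 2 * m * ((1 - m ^ 2) * (γ + δ)) + 2 * m ^ 3 := by
    have h1 : ‖2 * w₁ * (w₂ + v₂)‖ ≤ 2 * m * ((1 - m ^ 2) * (γ + δ)) := by
      rw [norm_mul, norm_mul, Complex.norm_ofNat]
      exact mul_le_mul_of_nonneg_left ((norm_add_le _ _).trans (by linarith)) (by positivity)
    have h2 : ‖2 * w₁ ^ 3‖ = 2 * m ^ 3 := by
      rw [norm_mul, norm_pow, Complex.norm_ofNat]
    calc ‖y‖ ≤ ‖w₃‖ + ‖v₃‖ + ‖2 * w₁ * (w₂ + v₂)‖ + ‖2 * w₁ ^ 3‖ :=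
          (norm_add_le _ _).trans (add_le_add_left ((norm_add_le _ _).trans
            (add_le_add_left (norm_sub_le _ _) _)) _)
      _ ≤ _ := by linarith
  -- The difference of the two fourth-order relations is solved for `a₄`, and `a₃ = x + a₂²` is
  -- substituted.
  have hH : ((8 * (1 + 2 * lam) : ℝ) : ℂ) * (a₂ * a₄ - a₃ ^ 2)
      = -((4 * (2 - lam) : ℝ) : ℂ) * a₂ ^ 4 + ((4 * (1 + 2 * lam) : ℝ) : ℂ) * a₂ ^ 2 * x
        + ((2 * B : ℝ) : ℂ) * a₂ * y - ((8 * (1 + 2 * lam) : ℝ) : ℂ) * x ^ 2 := by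
    push_cast
    linear_combination a₂ * (f₄ - g₄)
  have ha₂ : ‖a₂‖ = B * m := by
    rw [f₂, norm_mul, Complex.norm_real, Real.norm_of_nonneg hB.le]
  have hHn : 8 * (1 + 2 * lam) * ‖a₂ * a₄ - a₃ ^ 2‖ ≤ 4 * (2 - lam) * (B * m) ^ 4
      + 4 * (1 + 2 * lam) * (B * m) ^ 2 * ‖x‖ + 2 * B * (B * m) * ‖y‖
      + 8 * (1 + 2 * lam) * ‖x‖ ^ 2 := by
    have h1 := congrArg norm hH
    rw [norm_mul, Complex.norm_real, Real.norm_of_nonneg (by linarith)] at h1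
    rw [h1]
    refine (norm_sub_le _ _).trans (add_le_add ((norm_add_le _ _).trans (add_le_add
      ((norm_add_le _ _).trans (add_le_add ?_ ?_)) ?_)) ?_) <;>
    simp only [norm_mul, norm_neg, norm_pow, Complex.norm_real, ha₂]
    · rw [Real.norm_of_nonneg (by norm_num), Real.norm_of_nonneg (by linarith)]
    · rw [Real.norm_of_nonneg (by norm_num), Real.norm_of_nonneg (by linarith)]
    · rw [Real.norm_of_nonneg (by norm_num), Real.norm_of_nonneg hB.le]
    · rw [Real.norm_of_nonneg (by norm_num), Real.norm_of_nonneg (by linarith)]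
  refine ⟨m ^ 2, sq_nonneg _, by linarith, ?_⟩
  have hL : 0 < 1 + 2 * lam := by linarith
  have hM : 0 < 1 + lam := by linarith
  set S := (1 - m ^ 2) * (γ + δ) with hS
  have hS0 : 0 ≤ S := mul_nonneg hP (by linarith)
  have hS2 : S ≤ (1 - m ^ 2) * 2 := mul_le_mul_of_nonneg_left (by linarith) hP
  have hx2 : 9 * (1 + lam) ^ 2 * ‖x‖ ^ 2 ≤ B ^ 2 * S ^ 2 := by
    have h1 := pow_le_pow_left₀ (by positivity) hxn 2
    linarith
  -- This `e` is the relative weight of the `x²` term against the `y` term; the inequality amounts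
  -- to `(1 - lam) * (1 + 3 * lam) ≥ 0`, with equality at `lam = 1`.
  have he : 2 / 3 ≤ 8 * (1 + 2 * lam) / (9 * (1 + lam) ^ 2) := by
    rw [div_le_div_iff₀ (by norm_num) (by positivity)]
    nlinarith
  have hsch := schur_parameters_le hm0 hw₁ hγ0 hγ1 hδ0 hδ1 he
  have hsch' : 9 * (1 + lam) ^ 2 * (2 * m * (2 - (1 - m) * (γ ^ 2 + δ ^ 2))
      + 4 * m ^ 2 * (γ + δ)) ≤ 9 * (1 + lam) ^ 2 * (12 * m ^ 2)
        + 8 * (1 + 2 * lam) * ((1 - m ^ 2) * (4 - (γ + δ) ^ 2)) := by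
    refine (mul_le_mul_of_nonneg_left hsch (by positivity)).trans_eq ?_
    field_simp
  have hsch'' := mul_le_mul_of_nonneg_left hsch' (mul_nonneg (sq_nonneg B) hP)
  have t1 : 9 * (1 + lam) ^ 2 * (4 * (1 + 2 * lam) * (B * m) ^ 2 * ‖x‖)
      ≤ B ^ 2 * (24 * (1 + 2 * lam) * (1 + lam) * B * m ^ 2 * (1 - m ^ 2)) := by
    have h1 := mul_le_mul_of_nonneg_left (hxn.trans (mul_le_mul_of_nonneg_left hS2 hB.le))
      (by positivity : 0 ≤ 12 * (1 + lam) * (1 + 2 * lam) * (B * m) ^ 2)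
    linarith
  have t2 := mul_le_mul_of_nonneg_left hyn
    (by positivity : 0 ≤ 9 * (1 + lam) ^ 2 * (2 * B * (B * m)))
  have t3 := mul_le_mul_of_nonneg_left hx2 (by positivity : 0 ≤ 8 * (1 + 2 * lam))
  have t4 := mul_le_mul_of_nonneg_left hHn (by positivity : 0 ≤ 9 * (1 + lam) ^ 2)
  rw [hS] at t2 t3
  linarith

/-- Up to the factor `12 * (1 + lam)`, `h` says that the slope at `s = 1` is nonnegative. The value
at `1` minus the value at `s` is `s (1 - s)` times that slope plus `(1 - s)²` times the difference
of the values at `1` and `0`. -/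
theorem quadratic_le_endpoint {lam B s : ℝ} (hlam0 : 0 ≤ lam) (hlam1 : lam ≤ 1)
    (hs0 : 0 ≤ s) (hs1 : s ≤ 1)
    (h : 0 ≤ 6 * (1 + lam) * (2 - lam) * B ^ 2 - 2 * (1 + 2 * lam) * B - 3 * (1 + lam)) :
    36 * (1 + lam) ^ 2 * ((2 - lam) * B ^ 2 + 1) * s ^ 2
        + (24 * (1 + 2 * lam) * (1 + lam) * B + 108 * (1 + lam) ^ 2) * s * (1 - s)
        + 32 * (1 + 2 * lam) * (1 - s) ^ 2
      ≤ 36 * (1 + lam) ^ 2 * ((2 - lam) * B ^ 2 + 1) := by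
  have h1 : 0 ≤ (1 - s) * s * (12 * (1 + lam) *
      (6 * (1 + lam) * (2 - lam) * B ^ 2 - 2 * (1 + 2 * lam) * B - 3 * (1 + lam))) :=
    mul_nonneg (mul_nonneg (by linarith) hs0) (mul_nonneg (by linarith) h)
  have h2 : 0 ≤ (1 - s) ^ 2 * (36 * (1 + lam) ^ 2 * ((2 - lam) * B ^ 2)
      + (36 * (1 + lam) ^ 2 - 32 * (1 + 2 * lam))) := by
    refine mul_nonneg (sq_nonneg _) (add_nonneg ?_ (by nlinarith))
    exact mul_nonneg (by positivity) (mul_nonneg (by linarith) (sq_nonneg _))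
  linarith

/-- The leading coefficient is four times the denominator, which a negative slope at `s = 1` forces
to be negative; completing the square then bounds the quadratic by its vertex value for every real
`s`. -/
theorem quadratic_le_vertex {lam B s : ℝ} (hlam0 : 0 ≤ lam) (hB : 0 < B)
    (h : 6 * (1 + lam) * (2 - lam) * B ^ 2 - 2 * (1 + 2 * lam) * B - 3 * (1 + lam) < 0) :
    36 * (1 + lam) ^ 2 * ((2 - lam) * B ^ 2 + 1) * s ^ 2
        + (24 * (1 + 2 * lam) * (1 + lam) * B + 108 * (1 + lam) ^ 2) * s * (1 - s)
        + 32 * (1 + 2 * lam) * (1 - s) ^ 2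
      ≤ (1 + lam) ^ 2 *
        ((36 * (8 * (1 + 2 * lam) * (2 - lam) - (1 + 2 * lam) ^ 2) * B ^ 2
            - 324 * (1 + lam) * (1 + 2 * lam) * B
            + 288 * (1 + 2 * lam) - 729 * (1 + lam) ^ 2) /
          (9 * (1 + lam) ^ 2 * (2 - lam) * B ^ 2
            - 6 * (1 + lam) * (1 + 2 * lam) * B
            + 8 * (1 + 2 * lam) - 18 * (1 + lam) ^ 2)) := by
  have hden : 9 * (1 + lam) ^ 2 * (2 - lam) * B ^ 2 - 6 * (1 + lam) * (1 + 2 * lam) * B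
      + 8 * (1 + 2 * lam) - 18 * (1 + lam) ^ 2 < 0 := by
    have h1 : 3 / 2 * (1 + lam) * (6 * (1 + lam) * (2 - lam) * B ^ 2 - 2 * (1 + 2 * lam) * B
        - 3 * (1 + lam)) < 0 := mul_neg_of_pos_of_neg (by linarith) h
    have h2 : 0 < (1 + lam) * (1 + 2 * lam) * B := by positivity
    nlinarith
  rw [← mul_div_assoc, le_div_iff_of_neg hden, ← sub_nonneg]
  refine (sq_nonneg (2 * (9 * (1 + lam) ^ 2 * (2 - lam) * B ^ 2
      - 6 * (1 + lam) * (1 + 2 * lam) * B + 8 * (1 + 2 * lam) - 18 * (1 + lam) ^ 2) * s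
    + 6 * (1 + 2 * lam) * (1 + lam) * B + 27 * (1 + lam) ^ 2 - 16 * (1 + 2 * lam))).trans_eq ?_
  ring

/-- The quadratic in `1 - β` has one negative and one positive root, since its root `r` of the
discriminant is at least `1 + 2 * lam`; only the positive root matters for `β < 1`, and it is `1 -
betaThreshold lam`. -/
theorem le_betaThreshold_iff {lam β : ℝ} (hlam0 : 0 ≤ lam) (hlam1 : lam ≤ 1) (hβ : β < 1) :
    β ≤ betaThreshold lam ↔ 0 ≤ 6 * (1 + lam) * (2 - lam) * (1 - β) ^ 2
      - 2 * (1 + 2 * lam) * (1 - β) - 3 * (1 + lam) := by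
  have hk : 0 < 6 * (1 + lam) * (2 - lam) := mul_pos (by linarith) (by linarith)
  have hΔ : 0 ≤ (1 + 2 * lam) ^ 2 + 18 * (1 + lam) ^ 2 * (2 - lam) :=
    add_nonneg (sq_nonneg _) (mul_nonneg (by positivity) (by linarith))
  set r := √((1 + 2 * lam) ^ 2 + 18 * (1 + lam) ^ 2 * (2 - lam)) with hr
  have hr2 : r ^ 2 = (1 + 2 * lam) ^ 2 + 18 * (1 + lam) ^ 2 * (2 - lam) := Real.sq_sqrt hΔ
  have hrL : 1 + 2 * lam ≤ r := by
    refine Real.le_sqrt_of_sq_le (le_add_of_nonneg_right ?_)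
    exact mul_nonneg (by positivity) (by linarith)
  have hpos : 0 < 6 * (1 + lam) * (2 - lam) * (1 - β) := mul_pos hk (by linarith)
  have hfac : 6 * (1 + lam) * (2 - lam) * (6 * (1 + lam) * (2 - lam) * (1 - β) ^ 2
      - 2 * (1 + 2 * lam) * (1 - β) - 3 * (1 + lam))
      = (6 * (1 + lam) * (2 - lam) * (1 - β) - (1 + 2 * lam) + r)
        * (6 * (1 + lam) * (2 - lam) * (1 - β) - (1 + 2 * lam) - r) := by
    linear_combination hr2
  rw [betaThreshold, ← hr, le_sub_comm, div_le_iff₀ hk, ← mul_nonneg_iff_of_pos_left hk, hfac,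
    mul_nonneg_iff_of_pos_left (by linarith)]
  constructor <;> intro h <;> linarith

end BiUniv

/-! ### The main theorem. -/

theorem theorem3 (lam β : ℝ) (hlam0 : 0 ≤ lam) (hlam1 : lam ≤ 1) (hβ0 : 0 ≤ β) (hβ1 : β < 1)
    (f : ℂ → ℂ) (a : ℕ → ℂ)
    (ha : ∀ z ∈ BiUniv.unitDisc, HasSum (fun n : ℕ => a (n + 2) * z ^ (n + 2)) (f z - z))
    (hf : BiUniv.MemClassG lam (BiUniv.halfPlaneMap β) f) :
    (β ∈ Set.Icc 0 (BiUniv.betaThreshold lam) →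
      ‖a 2 * a 4 - a 3 ^ 2‖ ≤
        (1 - β) ^ 2 / (2 * (1 + 2 * lam)) * ((2 - lam) * (1 - β) ^ 2 + 1)) ∧
    (β ∈ Set.Ioo (BiUniv.betaThreshold lam) 1 →
      ‖a 2 * a 4 - a 3 ^ 2‖ ≤
        (1 - β) ^ 2 / (72 * (1 + 2 * lam)) *
          ((36 * (8 * (1 + 2 * lam) * (2 - lam) - (1 + 2 * lam) ^ 2) * (1 - β) ^ 2
              - 324 * (1 + lam) * (1 + 2 * lam) * (1 - β)
              + 288 * (1 + 2 * lam) - 729 * (1 + lam) ^ 2) /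
            (9 * (1 + lam) ^ 2 * (2 - lam) * (1 - β) ^ 2
              - 6 * (1 + lam) * (1 + 2 * lam) * (1 - β)
              + 8 * (1 + 2 * lam) - 18 * (1 + lam) ^ 2))) := by
  obtain ⟨⟨⟨⟨fd, f0, f1⟩, -⟩, -⟩, hsf, g, ⟨gd, hgf⟩, hsg⟩ := hf
  have hcoeff : ∀ n, PowerSeries.coeff (n + 2) (BiUniv.taylor f) = a (n + 2) := by
    intro n
    -- The hypothesis on `a` concerns only indices from `2` on, so the normalised values `0` and `1`
    -- are put at indices `0` and `1`.
    refine BiUniv.coeff_taylor_of_hasSum (c := fun k => if k = 0 then 0 else if k = 1 then 1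
      else a k) (fun z hz => ?_) (n + 2)
    rw [← hasSum_nat_add_iff' 2]
    simpa [Finset.sum_range_succ] using ha z hz
  have fa := BiUniv.analyticAt_of_differentiableOn fd
  have ga := BiUniv.analyticAt_of_differentiableOn gd
  obtain ⟨b1, b2, b3, b4⟩ := BiUniv.coeff_taylor_inverse fa ga f0 f1 hgf (fun _ => rfl)
    (fun _ => rfl)
  rw [BiUniv.coeff_one_taylor] at b1
  obtain ⟨w₁, w₂, w₃, γ, hγ0, hγ1, hw₁, hw₂, hw₃, f₂, f₃, f₄⟩ :=
    BiUniv.coeff_of_isSubordinate fd f1 hsf (fun _ => rfl)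
  obtain ⟨v₁, v₂, v₃, δ, hδ0, hδ1, -, hv₂, hv₃, g₂, g₃, g₄⟩ :=
    BiUniv.coeff_of_isSubordinate gd b1 hsg (fun _ => rfl)
  rw [b2] at g₂ g₃ g₄
  rw [b3] at g₃ g₄
  rw [b4] at g₄
  rw [hcoeff 0] at f₂ f₃ f₄ g₂ g₃ g₄
  rw [hcoeff 1] at f₃ f₄ g₃ g₄
  rw [hcoeff 2] at f₄ g₄
  have hB : 0 < 1 - β := by linarith
  have hBc : (1 - (β : ℂ)) = ((1 - β : ℝ) : ℂ) := by push_cast; rfl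
  rw [hBc] at f₂ f₃ f₄ g₂ g₃ g₄
  obtain ⟨s, hs0, hs1, hs⟩ := BiUniv.hankel_le_quadratic hlam0 hlam1 hB hγ0 hγ1 hδ0 hδ1 hw₁ hw₂ hw₃
    hv₂ hv₃ f₂ f₃ f₄ g₂ g₃ g₄
  have hL : 0 < 1 + 2 * lam := by linarith
  have hM : 0 < 1 + lam := by linarith
  have hc : 0 < 72 * (1 + 2 * lam) * (1 + lam) ^ 2 := by positivity
  constructor
  · rintro ⟨-, hβ⟩
    rw [BiUniv.le_betaThreshold_iff hlam0 hlam1 hβ1] at hβ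
    refine le_of_mul_le_mul_left (hs.trans ((mul_le_mul_of_nonneg_left
      (BiUniv.quadratic_le_endpoint hlam0 hlam1 hs0 hs1 hβ) (sq_nonneg _)).trans_eq ?_)) hc
    field_simp
    ring
  · rintro ⟨hβ, -⟩
    rw [← not_le, BiUniv.le_betaThreshold_iff hlam0 hlam1 hβ1, not_le] at hβ
    refine le_of_mul_le_mul_left (hs.trans ((mul_le_mul_of_nonneg_left
      (BiUniv.quadratic_le_vertex hlam0 hB hβ) (sq_nonneg _)).trans_eq ?_)) hc
    rw [div_mul_eq_mul_div, ← mul_div_assoc, mul_assoc (72 * (1 + 2 * lam)), mul_comm, ← mul_assoc]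
    field_simp
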